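/- An MV-algebra is an algebra $(M;\oplus,{}^*,0,1)$ such that $(M;\oplus,0)$ is a commutative monoid and $x^{**}=x$, $x\oplus 1=1$, $x\oplus(x\oplus y^*)^*=y\oplus(y\oplus x^*)^*$ for all $x,y$; its natural order is $x\le y\iff x^*\oplus y=1$. An EMV-algebra is an algebra $(M;\vee,\wedge,\oplus,0)$ such that (i) $(M;\oplus,0)$ is a commutative monoid; (ii) $(M;\vee,\wedge)$ is a distributive lattice with bottom element $0$; (iii) for every idempotent $a$ (i.e. $a\oplus a=a$), the interval $[0,a]$ is closed under $\oplus$ and carries an MV-algebra structure $([0,a];\oplus,\lambda_a,0,a)$ whose natural order is the order inherited from $M$, so that $\lambda_a(x)=\min\{z\in[0,a]\mid z\oplus x=a\}$; (iv) every $x\in M$ lies below some idempotent. The real interval $[0,1]$ is an EMV-algebra with its usual order and $x\oplus y=\min\{x+y,1\}$. An EMV-homomorphism is a map $f$ preserving $\vee,\wedge,\oplus,0$ with $f(\lambda_b(x))=\lambda_{f(b)}(f(x))$ for every idempotent $b$ and every $x\le b$. A state-morphism on $M$ is an EMV-homomorphism $s:M\to[0,1]$ with $s(x)=1$ for some $x\in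 M$. Let $\mathcal{SM}(M)$ be the set of state-morphisms on $M$ with the weak topology, i.e. the subspace topology of the product topology on $[0,1]^M$. An ideal of $M$ is a non-empty downward closed subset closed under $\oplus$; it is maximal if it is proper and not properly contained in another proper ideal. Let $\mathrm{MaxI}(M)$ be the set of maximal ideals with the hull-kernel topology, whose open sets are the sets $\{A\in\mathrm{MaxI}(M)\mid A\not\supseteq I\}$, $I$ an ideal of $M$. For $x\in M$ put $S(x)=\{s\in\mathcal{SM}(M)\mid s(x)>0\}$ and $M(x)=\{A\in\mathrm{MaxI}(M)\mid x\notin A\}$. **Theorem.** Let $M$ be an EMV-algebra. Then $\mathcal{SM}(M)$ and $\mathrm{MaxI}(M)$ are locally compact Hausdorff spaces. For every idempotent $a\in M$, the sets $S(a)\subseteq\mathcal{SM}(M)$ and $M(a)\subseteq\mathrm{MaxI}(M)$ are compact and clopen. If $M$ has a top element, then $\mathcal{SM}(M)$ and $\mathrm{MaxI}(M)$ are compact. -/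

import Mathlib

/-- `(α; ⊕, *, 0, 1)` is an MV-algebra, the operations being given explicitly. -/
structure IsMVAlgebra {α : Type*} (oplus : α → α → α) (star : α → α) (zero one : α) : Prop where
  oplus_assoc : ∀ x y z, oplus (oplus x y) z = oplus x (oplus y z)
  oplus_comm : ∀ x y, oplus x y = oplus y x
  oplus_zero : ∀ x, oplus x zero = x
  star_star : ∀ x, star (star x) = x
  oplus_one : ∀ x, oplus x one = one
  lukasiewicz : ∀ x y,
    oplus x (star (oplus x (star y))) = oplus y (star (oplus y (star x)))

/-- `a` is an idempotent: `a ⊕ a = a` (the operation `⊕` is written `+`). -/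
def IsIdem {M : Type*} [Add M] (a : M) : Prop := a + a = a

/-- An EMV-algebra `(M; ∨, ∧, ⊕, 0)`, with `⊕` written `+`: a commutative monoid which is a
distributive lattice with bottom `0`, in which every element lies below an idempotent and, for
each idempotent `a`, the interval `[0, a]` is an MV-algebra `([0, a]; ⊕, λ_a, 0, a)` whose
natural order (`x ≤ y` iff `x* ⊕ y = 1`) is the order inherited from the lattice `M`. -/
class EMVAlgebra (M : Type*) extends DistribLattice M, AddCommMonoid M where
  zero_le_all : ∀ x : M, 0 ≤ x
  interval_mv : ∀ a : M, IsIdem a →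
    ∃ (hadd : ∀ x y : Set.Iic a, (x : M) + (y : M) ∈ Set.Iic a)
      (star : Set.Iic a → Set.Iic a),
      IsMVAlgebra (fun x y : Set.Iic a => (⟨(x : M) + (y : M), hadd x y⟩ : Set.Iic a)) star
        ⟨0, zero_le_all a⟩ ⟨a, le_refl a⟩ ∧
      ∀ x y : Set.Iic a, x ≤ y ↔ (star x : M) + (y : M) = a
  exists_idem_ge : ∀ x : M, ∃ a : M, IsIdem a ∧ x ≤ a

open Classical in
/-- `λ_a(x) = min {z ∈ [0, a] | z ⊕ x = a}`, used for an idempotent `a` and `x ≤ a` (where the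
minimum exists); the value is `0` if there is no minimum. -/
noncomputable def lam {M : Type*} [EMVAlgebra M] (a x : M) : M :=
  if h : ∃ w : M, IsLeast {z : M | z ≤ a ∧ z + x = a} w then h.choose else 0

/-- EMV-homomorphisms. -/
structure EMVHom (M₁ M₂ : Type*) [EMVAlgebra M₁] [EMVAlgebra M₂] where
  toFun : M₁ → M₂
  map_sup : ∀ x y, toFun (x ⊔ y) = toFun x ⊔ toFun y
  map_inf : ∀ x y, toFun (x ⊓ y) = toFun x ⊓ toFun y
  map_add : ∀ x y, toFun (x + y) = toFun x + toFun y
  map_zero : toFun 0 = 0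
  map_lam : ∀ b, IsIdem b → ∀ x, x ≤ b → toFun (lam b x) = lam (toFun b) (toFun x)

/-- The EMV-algebra of the real interval `[0, 1]`, where `x ⊕ y = min (x + y) 1`. -/
noncomputable instance unitIntervalEMV : EMVAlgebra unitInterval where
  toDistribLattice := inferInstance
  add x y := ⟨min ((x : ℝ) + y) 1, le_min (add_nonneg x.2.1 y.2.1) zero_le_one, min_le_right _ _⟩
  zero := 0
  nsmul := @nsmulRec _ ⟨0⟩ ⟨fun x y =>
    ⟨min ((x : ℝ) + y) 1, le_min (add_nonneg x.2.1 y.2.1) zero_le_one, min_le_right _ _⟩⟩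
  add_assoc x y z := by
    have hx := x.2; have hy := y.2; have hz := z.2
    apply Subtype.ext
    change min (min ((x : ℝ) + y) 1 + z) 1 = min ((x : ℝ) + min ((y : ℝ) + z) 1) 1
    simp only [Set.mem_Icc] at hx hy hz
    grind
  zero_add x := by
    apply Subtype.ext
    change min ((0 : ℝ) + x) 1 = x
    simpa using x.2.2
  add_zero x := by
    apply Subtype.ext
    change min ((x : ℝ) + 0) 1 = x
    simpa using x.2.2
  add_comm x y := by
    apply Subtype.ext
    change min ((x : ℝ) + y) 1 = min ((y : ℝ) + x) 1
    rw [add_comm]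
  zero_le_all x := x.2.1
  exists_idem_ge x := by
    refine ⟨1, Subtype.ext ?_, x.2.2⟩
    change min ((1 : ℝ) + 1) 1 = 1
    norm_num
  interval_mv a ha := by
    have ha' : min ((a : ℝ) + a) 1 = a := congrArg Subtype.val ha
    have h01 : (a : ℝ) = 0 ∨ (a : ℝ) = 1 := by
      rcases min_choice ((a : ℝ) + a) 1 with h | h
      · left; linarith
      · right; linarith
    have hle : ∀ x : Set.Iic a, (0 : ℝ) ≤ (x : unitInterval) ∧
        ((x : unitInterval) : ℝ) ≤ (a : ℝ) := fun x => ⟨x.1.2.1, x.2⟩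
    refine ⟨fun x y => ?_, fun x => ⟨⟨(a : ℝ) - (x : unitInterval),
      sub_nonneg.2 (hle x).2, ?_⟩, ?_⟩, ⟨?_, ?_, ?_, ?_, ?_, ?_⟩, ?_⟩
    · have := hle x; have := hle y
      change min (((x : unitInterval) : ℝ) + (y : unitInterval)) 1 ≤ (a : ℝ)
      grind
    · have := hle x; have := a.2.2
      linarith
    · have := hle x
      change (a : ℝ) - (x : unitInterval) ≤ (a : ℝ)
      linarith
    · intro x y z
      have := hle x; have := hle y; have := hle z
      apply Subtype.ext; apply Subtype.ext
      change min (min (((x : unitInterval) : ℝ) + (y : unitInterval)) 1 + (z : unitInterval)) 1 =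
        min (((x : unitInterval) : ℝ) + min (((y : unitInterval) : ℝ) + (z : unitInterval)) 1) 1
      grind
    · intro x y
      apply Subtype.ext; apply Subtype.ext
      change min (((x : unitInterval) : ℝ) + (y : unitInterval)) 1 =
        min (((y : unitInterval) : ℝ) + (x : unitInterval)) 1
      rw [add_comm]
    · intro x
      have := hle x
      apply Subtype.ext; apply Subtype.ext
      change min (((x : unitInterval) : ℝ) + 0) 1 = (x : unitInterval)
      grind
    · intro x
      apply Subtype.ext; apply Subtype.ext
      change (a : ℝ) - ((a : ℝ) - (x : unitInterval)) = (x : unitInterval)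
      ring
    · intro x
      have := hle x
      apply Subtype.ext; apply Subtype.ext
      change min (((x : unitInterval) : ℝ) + a) 1 = a
      grind
    · intro x y
      have := hle x; have := hle y
      apply Subtype.ext; apply Subtype.ext
      change min (((x : unitInterval) : ℝ) +
          (a - min (((x : unitInterval) : ℝ) + (a - (y : unitInterval))) 1)) 1 =
        min (((y : unitInterval) : ℝ) +
          (a - min (((y : unitInterval) : ℝ) + (a - (x : unitInterval))) 1)) 1
      grind
    · intro x y
      have := hle x; have := hle y
      have hiff : x ≤ y ↔ ((x : unitInterval) : ℝ) ≤ (y : unitInterval) := Iff.rfl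
      rw [hiff, Subtype.ext_iff]
      change _ ↔ min ((a : ℝ) - (x : unitInterval) + (y : unitInterval)) 1 = a
      grind

/-- State-morphisms: EMV-homomorphisms `s : M → [0, 1]` with `s x = 1` for some `x`. -/
def StateMorphism (M : Type*) [EMVAlgebra M] : Type _ :=
  {s : EMVHom M unitInterval // ∃ x : M, s.toFun x = 1}

/-- The weak topology on state-morphisms: the topology induced by the product topology of
`[0, 1]^M`. -/
instance StateMorphism.instTopologicalSpace (M : Type*) [EMVAlgebra M] :
    TopologicalSpace (StateMorphism M) :=
  TopologicalSpace.induced (fun s => (s.1.toFun : M → unitInterval)) inferInstance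

/-- `S(x)`, the set of state-morphisms that are positive at `x`. -/
def stateSupport {M : Type*} [EMVAlgebra M] (x : M) : Set (StateMorphism M) :=
  {s | 0 < s.1.toFun x}

/-- Ideals of an EMV-algebra. -/
structure IsEMVIdeal {M : Type*} [EMVAlgebra M] (I : Set M) : Prop where
  nonempty : I.Nonempty
  mem_of_le : ∀ x y, x ≤ y → y ∈ I → x ∈ I
  add_mem : ∀ x y, x ∈ I → y ∈ I → x + y ∈ I

/-- `MaxI(M)`: the maximal ideals, i.e. the proper ideals that are not properly contained in
another proper ideal. -/
def MaxI (M : Type*) [EMVAlgebra M] : Type _ :=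
  {A : Set M // Maximal (fun J : Set M => IsEMVIdeal J ∧ J ≠ Set.univ) A}

/-- `O(I)`, the set of maximal ideals that do not contain `I`. -/
def hullCompl {M : Type*} [EMVAlgebra M] (I : Set M) : Set (MaxI M) := {A | ¬ I ⊆ A.1}

/-- `M(x)`, the set of maximal ideals that do not contain the element `x`. -/
def idealSupport {M : Type*} [EMVAlgebra M] (x : M) : Set (MaxI M) := {A | x ∉ A.1}

section HullKernel

/-- Residuation inside an interval `[0, a]`: there is an operation `w ⊖ x` with
`w ⊖ x ≤ y ↔ w ≤ x ⊕ y`. -/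
theorem EMVAlgebra.exists_residual {M : Type*} [EMVAlgebra M] {a : M} (ha : IsIdem a) {w x : M}
    (hw : w ≤ a) (hx : x ≤ a) : ∃ d : M, d ≤ a ∧ ∀ y, y ≤ a → (d ≤ y ↔ w ≤ x + y) := by
  obtain ⟨hadd, star, hmv, hle⟩ := EMVAlgebra.interval_mv a ha
  refine ⟨star ⟨star ⟨w, hw⟩ + x, hadd _ ⟨x, hx⟩⟩, (star _).2, fun y hy => ?_⟩
  have h1 := hle (star ⟨star ⟨w, hw⟩ + x, hadd _ ⟨x, hx⟩⟩) ⟨y, hy⟩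
  have h2 := hle ⟨w, hw⟩ ⟨x + y, hadd ⟨x, hx⟩ ⟨y, hy⟩⟩
  rw [hmv.star_star] at h1
  simp only [add_assoc] at h1
  exact h1.trans h2.symm

theorem EMVAlgebra.exists_idem_ge₃ {M : Type*} [EMVAlgebra M] (x y z : M) :
    ∃ a : M, IsIdem a ∧ x ≤ a ∧ y ≤ a ∧ z ≤ a := by
  obtain ⟨a, ha, h⟩ := EMVAlgebra.exists_idem_ge (x ⊔ (y ⊔ z))
  exact ⟨a, ha, le_sup_left.trans h, (le_sup_left.trans le_sup_right).trans h,
    (le_sup_right.trans le_sup_right).trans h⟩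

theorem EMVAlgebra.add_le_idem {M : Type*} [EMVAlgebra M] {a x y : M} (ha : IsIdem a)
    (hx : x ≤ a) (hy : y ≤ a) : x + y ≤ a := by
  obtain ⟨hadd, -⟩ := EMVAlgebra.interval_mv a ha
  exact hadd ⟨x, hx⟩ ⟨y, hy⟩

theorem EMVAlgebra.add_le_add_left' {M : Type*} [EMVAlgebra M] {x y : M} (z : M) (h : x ≤ y) :
    z + x ≤ z + y := by
  obtain ⟨a, ha, hx, hy, hz⟩ := EMVAlgebra.exists_idem_ge₃ x y z
  obtain ⟨d, -, hd⟩ := EMVAlgebra.exists_residual ha (EMVAlgebra.add_le_idem ha hz hx) hz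
  exact (hd y hy).1 (((hd x hx).2 le_rfl).trans h)

theorem EMVAlgebra.add_le_add' {M : Type*} [EMVAlgebra M] {x y z w : M} (h : x ≤ y)
    (h' : z ≤ w) : x + z ≤ y + w := by
  refine (EMVAlgebra.add_le_add_left' x h').trans ?_
  rw [add_comm x, add_comm y]
  exact EMVAlgebra.add_le_add_left' w h

/-- `⊕` distributes over `∧` (the nontrivial inequality). -/
theorem EMVAlgebra.le_add_inf {M : Type*} [EMVAlgebra M] {w x y z : M} (h : w ≤ x + y)
    (h' : w ≤ x + z) : w ≤ x + y ⊓ z := by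
  obtain ⟨a, ha, hx, hy, hz⟩ := EMVAlgebra.exists_idem_ge₃ x y z
  obtain ⟨d, -, hd⟩ :=
    EMVAlgebra.exists_residual ha (h.trans (EMVAlgebra.add_le_idem ha hx hy)) hx
  exact (hd _ (inf_le_left.trans hy)).1 (le_inf ((hd y hy).2 h) ((hd z hz).2 h'))

theorem EMVAlgebra.le_self_add {M : Type*} [EMVAlgebra M] (x y : M) : x ≤ x + y := by
  simpa using EMVAlgebra.add_le_add_left' x (EMVAlgebra.zero_le_all y)

/-- `y ∧ (u ⊕ v) ≤ (y ∧ u) ⊕ (y ∧ v)`. -/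
theorem EMVAlgebra.inf_add_le {M : Type*} [EMVAlgebra M] (y u v : M) :
    y ⊓ (u + v) ≤ y ⊓ u + y ⊓ v := by
  have key : ∀ p q, y ⊓ (u + v) ≤ p + q → y ⊓ (u + v) ≤ q + p := fun p q h => by
    rwa [add_comm q p]
  refine EMVAlgebra.le_add_inf (key _ _ (EMVAlgebra.le_add_inf ?_ ?_))
    (key _ _ (EMVAlgebra.le_add_inf ?_ ?_))
  · exact inf_le_left.trans (EMVAlgebra.le_self_add y y)
  · exact inf_le_left.trans (EMVAlgebra.le_self_add y u)
  · exact key _ _ (inf_le_left.trans (EMVAlgebra.le_self_add y v))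
  · exact key _ _ inf_le_right

theorem IsEMVIdeal.zero_mem {M : Type*} [EMVAlgebra M] {I : Set M} (hI : IsEMVIdeal I) :
    (0 : M) ∈ I :=
  hI.nonempty.elim fun x hx => hI.mem_of_le 0 x (EMVAlgebra.zero_le_all x) hx

theorem IsEMVIdeal.nsmul_mem {M : Type*} [EMVAlgebra M] {I : Set M} (hI : IsEMVIdeal I) {x : M}
    (hx : x ∈ I) (n : ℕ) : n • x ∈ I := by
  induction n with
  | zero => simpa using hI.zero_mem
  | succ n ih => rw [succ_nsmul]; exact hI.add_mem _ _ ih hx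

theorem EMVAlgebra.inf_nsmul_le {M : Type*} [EMVAlgebra M] (y x : M) (n : ℕ) :
    y ⊓ n • x ≤ n • (y ⊓ x) := by
  induction n with
  | zero => simp
  | succ n ih =>
    rw [succ_nsmul, succ_nsmul]
    exact (EMVAlgebra.inf_add_le _ _ _).trans (EMVAlgebra.add_le_add' ih le_rfl)

/-- Maximal ideals are prime. -/
theorem MaxI.mem_or_mem {M : Type*} [EMVAlgebra M] (A : MaxI M) {x y : M} (h : x ⊓ y ∈ A.1) :
    x ∈ A.1 ∨ y ∈ A.1 := by
  by_contra! hxy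
  obtain ⟨hx, hy⟩ := hxy
  have hA : IsEMVIdeal A.1 := A.2.prop.1
  let J : Set M := {z | ∃ p ∈ A.1, ∃ n : ℕ, z ≤ p + n • x}
  have hJ : IsEMVIdeal J := by
    refine ⟨⟨0, 0, hA.zero_mem, 0, by simp⟩, ?_, ?_⟩
    · rintro u v huv ⟨p, hp, n, hv⟩
      exact ⟨p, hp, n, huv.trans hv⟩
    · rintro u v ⟨p, hp, n, hu⟩ ⟨q, hq, m, hv⟩
      refine ⟨p + q, hA.add_mem _ _ hp hq, n + m, (EMVAlgebra.add_le_add' hu hv).trans ?_⟩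
      rw [add_nsmul, add_add_add_comm]
  have hAJ : A.1 ⊆ J := fun p hp => ⟨p, hp, 0, by simp⟩
  have hxJ : x ∈ J := ⟨0, hA.zero_mem, 1, by simp⟩
  have hJu : J = Set.univ := by
    by_contra hne
    exact hx (A.2.le_of_ge ⟨hJ, hne⟩ hAJ hxJ)
  obtain ⟨p, hp, n, hyp⟩ : y ∈ J := hJu ▸ Set.mem_univ y
  refine hy (hA.mem_of_le y (y ⊓ p + n • (y ⊓ x)) ?_ (hA.add_mem _ _
    (hA.mem_of_le _ p inf_le_right hp) (hA.nsmul_mem (by rwa [inf_comm]) n)))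
  calc y ≤ y ⊓ (p + n • x) := le_inf le_rfl hyp
    _ ≤ y ⊓ p + y ⊓ n • x := EMVAlgebra.inf_add_le _ _ _
    _ ≤ y ⊓ p + n • (y ⊓ x) := EMVAlgebra.add_le_add' le_rfl (EMVAlgebra.inf_nsmul_le _ _ _)

/-- The hull-kernel topology on `MaxI(M)`: the open sets are the sets `O(I)`, `I` an ideal. -/
instance MaxI.instTopologicalSpace (M : Type*) [EMVAlgebra M] : TopologicalSpace (MaxI M) where
  IsOpen U := ∃ I : Set M, IsEMVIdeal I ∧ U = hullCompl I
  isOpen_univ := by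
    refine ⟨Set.univ, ⟨⟨0, trivial⟩, fun _ _ _ _ => trivial, fun _ _ _ _ => trivial⟩, ?_⟩
    symm
    rw [Set.eq_univ_iff_forall]
    exact fun A hA => A.2.prop.2 (Set.univ_subset_iff.1 hA)
  isOpen_inter := by
    rintro _ _ ⟨I, hI, rfl⟩ ⟨J, hJ, rfl⟩
    refine ⟨I ∩ J, ⟨⟨0, hI.zero_mem, hJ.zero_mem⟩, fun x y hxy hy =>
      ⟨hI.mem_of_le x y hxy hy.1, hJ.mem_of_le x y hxy hy.2⟩, fun x y hx hy =>
      ⟨hI.add_mem x y hx.1 hy.1, hJ.add_mem x y hx.2 hy.2⟩⟩, ?_⟩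
    ext A
    constructor
    · rintro ⟨h1, h2⟩ h
      obtain ⟨x, hx, hxA⟩ := Set.not_subset.1 h1
      obtain ⟨y, hy, hyA⟩ := Set.not_subset.1 h2
      have hxy : x ⊓ y ∈ A.1 :=
        h ⟨hI.mem_of_le _ x inf_le_left hx, hJ.mem_of_le _ y inf_le_right hy⟩
      exact (A.mem_or_mem hxy).elim hxA hyA
    · intro h
      exact ⟨fun h' => h (Set.inter_subset_left.trans h'),
        fun h' => h (Set.inter_subset_right.trans h')⟩
  isOpen_sUnion := by
    intro S hS
    let K : Set M := ⋂₀ {L | IsEMVIdeal L ∧ ∀ I, IsEMVIdeal I → hullCompl I ∈ S → I ⊆ L}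
    refine ⟨K, ⟨⟨0, fun L hL => hL.1.zero_mem⟩, fun x y hxy hy L hL =>
      hL.1.mem_of_le x y hxy (hy L hL), fun x y hx hy L hL =>
      hL.1.add_mem x y (hx L hL) (hy L hL)⟩, ?_⟩
    ext A
    constructor
    · rintro ⟨U, hU, hAU⟩ hKA
      obtain ⟨I, hI, rfl⟩ := hS U hU
      exact hAU fun x hx => hKA fun L hL => hL.2 I hI hU hx
    · intro hA
      by_contra hAS
      refine hA fun x hx => hx A.1 ⟨A.2.prop.1, fun I hI hIS => ?_⟩
      by_contra hIA
      exact hAS ⟨hullCompl I, hIS, hIA⟩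

end HullKernel

/-! Everything reduces to the sets `S(a)` and `M(a)` for idempotent `a`: they are compact and
clopen, they cover their spaces because every element lies below an idempotent, and a top element is
an idempotent whose set is the whole space. With Hausdorffness this gives local compactness. For
state-morphisms, idempotents of `[0,1]` are `0` and `1`, so `S(a)` is cut out by `s a = 1`; since
`lam b x` is `b - x` there, all conditions are closed and `S(a)` is compact by Tychonoff. For
maximal ideals, compactness comes from ultrafilter limits of ideals, extended by
`MaxI.exists_ge_notMem`. Primeness separates points through disjoint differences
(`exists_disjoint_differences`), and relative complements of idempotents (`exists_relative_compl`)
make `M(a)` closed. -/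

/-! ### Differences, relative complements and ideals. -/

namespace EMVAlgebra

variable {M : Type*} [EMVAlgebra M]

/-- Subtraction of `m ≤ x`, with a difference meeting trivially all `w` absorbed by `m`. -/
theorem exists_add_eq {m x : M} (h : m ≤ x) :
    ∃ u : M, m + u = x ∧ ∀ w, w ≤ u → m + w = m → w = 0 := by
  obtain ⟨a, ha, hxa⟩ := exists_idem_ge x
  obtain ⟨hadd, star, hmv, hle⟩ := interval_mv a ha
  let op : Set.Iic a → Set.Iic a → Set.Iic a := fun x y => ⟨(x : M) + (y : M), hadd x y⟩
  let o : Set.Iic a := ⟨0, zero_le_all a⟩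
  let e : Set.Iic a := ⟨a, le_refl a⟩
  have hmv' : IsMVAlgebra op star o e := hmv
  have hle' : ∀ p q : Set.Iic a, p ≤ q ↔ op (star p) q = e := fun p q =>
    (hle p q).trans (Subtype.ext_iff (a1 := op (star p) q) (a2 := e)).symm
  have hose : star e = o := by
    have h1 := hmv'.oplus_one (star o)
    have h2 := (hle' o o).1 le_rfl
    rw [hmv'.oplus_zero] at h2
    rw [← h2, hmv'.star_star]
  let m' : Set.Iic a := ⟨m, h.trans hxa⟩
  let x' : Set.Iic a := ⟨x, hxa⟩
  have hmx : op (star m') x' = e := (hle' m' x').1 h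
  have hself : ∀ p : Set.Iic a, op p (star p) = e := fun p => by
    rw [hmv'.oplus_comm]
    exact (hle' p p).1 le_rfl
  -- The difference is `(m ⊕ x*)*`, computed in `[0, a]`; the Łukasiewicz axiom for `m` and `x`
  -- gives `m ⊕ u = x`.
  refine ⟨star (op m' (star x')), ?_, fun w hw hmw => ?_⟩
  · have h1 := hmv'.lukasiewicz m' x'
    rw [hmv'.oplus_comm x' (star m'), hmx, hose, hmv'.oplus_zero] at h1
    exact congrArg Subtype.val h1
  · let w' : Set.Iic a := ⟨w, hw.trans (star _).2⟩
    -- Since `w ≤ u ≤ m*`, the axiom for `w*` and `m` collapses to `w* = m ⊕ (m ⊕ w)* = m ⊕ m* = 1`.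
    have hw' : op (star w') (star m') = e := by
      refine (hle' w' (star m')).1 (le_trans (b := star (op m' (star x'))) hw ?_)
      rw [hle', hmv'.star_star, hmv'.oplus_comm m', hmv'.oplus_assoc, hself, hmv'.oplus_one]
    have hmw' : op m' w' = m' := Subtype.ext hmw
    have h1 := hmv'.lukasiewicz (star w') m'
    rw [hw', hose, hmv'.oplus_zero, hmv'.star_star, hmw', hself] at h1
    have h2 : w' = o := by rw [← hmv'.star_star w', h1, hose]
    exact congrArg Subtype.val h2

/-- Prelinearity: the truncated differences of `x` and `y` are disjoint. -/
theorem exists_disjoint_differences (x y : M) :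
    ∃ u v : M, x ⊓ y + u = x ∧ x ⊓ y + v = y ∧ u ⊓ v = 0 := by
  obtain ⟨u, hu, hu'⟩ := exists_add_eq (inf_le_left : x ⊓ y ≤ x)
  obtain ⟨v, hv, -⟩ := exists_add_eq (inf_le_right : x ⊓ y ≤ y)
  -- Adding `u ⊓ v` to `x ⊓ y` stays below both `x` and `y`, so `x ⊓ y` absorbs it.
  refine ⟨u, v, hu, hv, hu' _ inf_le_left (le_antisymm (le_inf ?_ ?_) (le_self_add _ _))⟩
  · exact (add_le_add_left' _ inf_le_left).trans hu.le
  · exact (add_le_add_left' _ inf_le_right).trans hv.le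

/-- An idempotent absorbs everything below it, so the difference of `b` and `a` can meet `a` only in
`0`. -/
theorem exists_relative_compl {a b : M} (ha : IsIdem a) (hab : a ≤ b) :
    ∃ c : M, a + c = b ∧ c ⊓ a = 0 := by
  obtain ⟨c, hc, hc'⟩ := exists_add_eq hab
  exact ⟨c, hc, hc' _ inf_le_left (le_antisymm
    ((add_le_add_left' a inf_le_right).trans (le_of_eq ha)) (le_self_add _ _))⟩

theorem eq_zero_of_le {x : M} (h : x ≤ 0) : x = 0 := le_antisymm h (zero_le_all x)

theorem isEMVIdeal_disjoint (a : M) : IsEMVIdeal {x : M | a ⊓ x = 0} := by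
  refine ⟨⟨0, inf_eq_right.2 (zero_le_all a)⟩, fun x y h hy => eq_zero_of_le ?_,
    fun x y hx hy => eq_zero_of_le ?_⟩
  · exact (inf_le_inf_left a h).trans (le_of_eq hy)
  · refine (inf_add_le a x y).trans ?_
    rw [Set.mem_ofPred_eq] at hx hy
    rw [hx, hy, add_zero]

/-- The ideal generated by an ideal and an element. -/
theorem isEMVIdeal_adjoin {I : Set M} (hI : IsEMVIdeal I) (x : M) :
    IsEMVIdeal {z : M | ∃ p ∈ I, ∃ n : ℕ, z ≤ p + n • x} := by
  refine ⟨⟨0, 0, hI.zero_mem, 0, by simp⟩, ?_, ?_⟩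
  · rintro u v huv ⟨p, hp, n, hv⟩
    exact ⟨p, hp, n, huv.trans hv⟩
  · rintro u v ⟨p, hp, n, hu⟩ ⟨q, hq, m, hv⟩
    refine ⟨p + q, hI.add_mem _ _ hp hq, n + m, (add_le_add' hu hv).trans ?_⟩
    rw [add_nsmul, add_add_add_comm]

end EMVAlgebra

open EMVAlgebra

/-! ### The space of maximal ideals. -/

namespace MaxI

variable {M : Type*} [EMVAlgebra M]

theorem isEMVIdeal (A : MaxI M) : IsEMVIdeal A.1 := A.2.prop.1

/-- An ideal missing the idempotent `a` extends to a maximal ideal missing `a`. -/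
theorem exists_ge_notMem {a : M} (ha : IsIdem a) {I : Set M} (hI : IsEMVIdeal I) (haI : a ∉ I) :
    ∃ A : MaxI M, I ⊆ A.1 ∧ a ∉ A.1 := by
  obtain ⟨A, hIA, hA⟩ := zorn_subset_nonempty {J : Set M | IsEMVIdeal J ∧ a ∉ J}
    (fun c hc hchain hne => by
      refine ⟨⋃₀ c, ⟨⟨?_, ?_, ?_⟩, ?_⟩, fun s hs => Set.subset_sUnion_of_mem hs⟩
      · obtain ⟨J, hJ⟩ := hne
        exact ⟨0, J, hJ, (hc hJ).1.zero_mem⟩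
      · rintro x y hxy ⟨J, hJ, hy⟩
        exact ⟨J, hJ, (hc hJ).1.mem_of_le x y hxy hy⟩
      · rintro x y ⟨J, hJ, hx⟩ ⟨K, hK, hy⟩
        rcases hchain.total hJ hK with h | h
        · exact ⟨K, hK, (hc hK).1.add_mem x y (h hx) hy⟩
        · exact ⟨J, hJ, (hc hJ).1.add_mem x y hx (h hy)⟩
      · rintro ⟨J, hJ, haJ⟩
        exact (hc hJ).2 haJ) I ⟨hI, haI⟩
  -- `A` is so far maximal only among ideals missing `a`. Adjoining a `z` disjoint from `a` cannot
  -- capture `a`, so `A` already contains `z`.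
  have hdisj : ∀ z, z ⊓ a = 0 → z ∈ A := fun z hz => by
    refine hA.le_of_ge ⟨isEMVIdeal_adjoin hA.prop.1 z, ?_⟩ (fun p hp => ⟨p, hp, 0, by simp⟩)
      ⟨0, hA.prop.1.zero_mem, 1, by simp⟩
    rintro ⟨p, hp, n, hn⟩
    refine hA.prop.2 (hA.prop.1.mem_of_le a p ?_ hp)
    calc a ≤ a ⊓ (p + n • z) := le_inf le_rfl hn
      _ ≤ a ⊓ p + a ⊓ n • z := inf_add_le _ _ _
      _ ≤ a ⊓ p + n • (a ⊓ z) := add_le_add' le_rfl (inf_nsmul_le _ _ _)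
      _ = a ⊓ p := by rw [inf_comm a z, hz, smul_zero, add_zero]
      _ ≤ p := inf_le_right
  refine ⟨⟨A, ⟨hA.prop.1, fun h => hA.prop.2 (h ▸ Set.mem_univ a)⟩, fun B hB hAB => ?_⟩,
    hIA, hA.prop.2⟩
  by_contra hBA
  have haB : a ∈ B := by
    by_contra haB
    exact hBA (hA.le_of_ge ⟨hB.1, haB⟩ hAB)
  -- An ideal above `A` containing `a` also contains all relative complements of `a`, hence
  -- everything.
  refine hB.2 (Set.eq_univ_of_forall fun x => ?_)
  obtain ⟨b, -, hb⟩ := exists_idem_ge (a ⊔ x)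
  obtain ⟨c, hc, hca⟩ := exists_relative_compl ha (le_sup_left.trans hb)
  exact hB.1.mem_of_le x b (le_sup_right.trans hb)
    (hc ▸ hB.1.add_mem a c haB (hAB (hdisj c hca)))

theorem exists_idem_notMem (A : MaxI M) : ∃ a : M, IsIdem a ∧ a ∉ A.1 := by
  obtain ⟨x, hx⟩ := (Set.ne_univ_iff_exists_notMem _).1 A.2.prop.2
  obtain ⟨a, ha, hxa⟩ := exists_idem_ge x
  exact ⟨a, ha, fun h => hx (A.isEMVIdeal.mem_of_le x a hxa h)⟩

theorem isOpen_hullCompl {I : Set M} (hI : IsEMVIdeal I) : IsOpen (hullCompl I) := ⟨I, hI, rfl⟩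

theorem isOpen_idealSupport (x : M) : IsOpen (idealSupport x) := by
  have h0 : IsEMVIdeal ({0} : Set M) :=
    ⟨⟨0, rfl⟩, fun u v h hv => eq_zero_of_le (h.trans (le_of_eq hv)), fun u v hu hv => by
      rw [Set.mem_singleton_iff] at *; rw [hu, hv, add_zero]⟩
  convert isOpen_hullCompl (isEMVIdeal_adjoin h0 x) using 1
  ext A
  refine not_congr ⟨?_, fun h => h ⟨0, rfl, 1, by simp⟩⟩
  rintro hx z ⟨p, rfl, n, hz⟩
  exact A.isEMVIdeal.mem_of_le z _ hz
    (A.isEMVIdeal.add_mem _ _ A.isEMVIdeal.zero_mem (A.isEMVIdeal.nsmul_mem hx n))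

/-- The complement is `O(I)` for `I` the annihilator of `a`: a proper ideal cannot contain both `a`
and its annihilator, and a prime ideal missing `a` contains the annihilator. -/
theorem isClosed_idealSupport {a : M} (ha : IsIdem a) : IsClosed (idealSupport a) := by
  rw [← isOpen_compl_iff]
  convert isOpen_hullCompl (isEMVIdeal_disjoint a) using 1
  ext A
  constructor
  · intro h hI
    have haA : a ∈ A.1 := not_not.1 h
    refine A.2.prop.2 (Set.eq_univ_of_forall fun x => ?_)
    obtain ⟨b, -, hb⟩ := exists_idem_ge (a ⊔ x)
    obtain ⟨c, hc, hca⟩ := exists_relative_compl ha (le_sup_left.trans hb)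
    have hcA : c ∈ A.1 := hI (by rwa [Set.mem_ofPred_eq, inf_comm])
    exact A.isEMVIdeal.mem_of_le x b (le_sup_right.trans hb)
      (hc ▸ A.isEMVIdeal.add_mem a c haA hcA)
  · intro h haA
    refine h fun x hx => (A.mem_or_mem (x := a) (y := x) ?_).resolve_left haA
    rw [Set.mem_ofPred_eq] at hx
    rw [hx]
    exact A.isEMVIdeal.zero_mem

theorem isCompact_idealSupport {a : M} (ha : IsIdem a) : IsCompact (idealSupport a) := by
  rw [isCompact_iff_ultrafilter_le_nhds']
  intro F hF
  -- `P` is the limit of the ideals along `F`. It misses `a`, and `F` converges to any maximal ideal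
  -- containing `P`.
  let P : Set M := {x | ∀ᶠ A : MaxI M in F, x ∈ A.1}
  have hP : IsEMVIdeal P :=
    ⟨⟨0, Filter.Eventually.of_forall fun A => A.isEMVIdeal.zero_mem⟩,
      fun x y h hy => hy.mono fun A hA => A.isEMVIdeal.mem_of_le x y h hA,
      fun x y hx hy => (hx.and hy).mono fun A hA => A.isEMVIdeal.add_mem x y hA.1 hA.2⟩
  obtain ⟨A, hPA, haA⟩ := exists_ge_notMem ha hP (Ultrafilter.eventually_not.1 hF)
  refine ⟨A, haA, fun s hs => ?_⟩
  obtain ⟨U, hUs, ⟨I, -, rfl⟩, hAU⟩ := mem_nhds_iff.1 hs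
  obtain ⟨x, hxI, hxA⟩ := Set.not_subset.1 hAU
  have hx : ∀ᶠ B : MaxI M in F, x ∉ B.1 := Ultrafilter.eventually_not.2 fun h => hxA (hPA h)
  exact Filter.mem_of_superset hx fun B hB => hUs fun h => hB (h hxI)

instance : T2Space (MaxI M) := by
  refine ⟨fun A B hAB => ?_⟩
  have hsub : ∀ {A B : MaxI M}, A ≠ B → ∃ x ∈ A.1, x ∉ B.1 := fun {A B} h => by
    by_contra! hle
    exact h (Subtype.ext (Set.Subset.antisymm hle (A.2.le_of_ge B.2.prop hle)))
  obtain ⟨x, hxA, hxB⟩ := hsub hAB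
  obtain ⟨y, hyB, hyA⟩ := hsub hAB.symm
  -- As `x ⊓ y` lies in both ideals, `v ∈ A` would force `y ∈ A`, and `u ∈ B` would force `x ∈ B`;
  -- primeness makes `M(u)` and `M(v)` disjoint.
  obtain ⟨u, v, hu, hv, huv⟩ := exists_disjoint_differences x y
  refine ⟨idealSupport v, idealSupport u, isOpen_idealSupport v, isOpen_idealSupport u,
    fun h => hyA ?_, fun h => hxB ?_, Set.disjoint_left.2 fun C hCv hCu => ?_⟩
  · exact hv ▸ A.isEMVIdeal.add_mem _ _ (A.isEMVIdeal.mem_of_le _ x inf_le_left hxA) h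
  · exact hu ▸ B.isEMVIdeal.add_mem _ _ (B.isEMVIdeal.mem_of_le _ y inf_le_right hyB) h
  · exact (C.mem_or_mem (huv ▸ C.isEMVIdeal.zero_mem : u ⊓ v ∈ C.1)).elim hCu hCv

instance : WeaklyLocallyCompactSpace (MaxI M) := by
  refine ⟨fun A => ?_⟩
  obtain ⟨a, ha, haA⟩ := A.exists_idem_notMem
  exact ⟨_, isCompact_idealSupport ha, (isOpen_idealSupport a).mem_nhds haA⟩

end MaxI

/-! ### Idempotents and `lam` in the real unit interval. -/

theorem unitInterval.coe_emv_add (x y : unitInterval) :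
    ((x + y : unitInterval) : ℝ) = min ((x : ℝ) + y) 1 := rfl

theorem unitInterval.isIdem_iff {x : unitInterval} : IsIdem x ↔ x = 0 ∨ x = 1 := by
  rw [IsIdem, Subtype.ext_iff, unitInterval.coe_emv_add, Subtype.ext_iff, Subtype.ext_iff]
  change _ ↔ (x : ℝ) = 0 ∨ (x : ℝ) = 1
  grind

/-- Replaces a minimum by a continuous expression, so that preservation of `lam` becomes a closed
condition. -/
theorem unitInterval.coe_lam {b x : unitInterval} (hb : IsIdem b) (hx : x ≤ b) :
    ((lam b x : unitInterval) : ℝ) = b - x := by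
  have hx' : (x : ℝ) ≤ b := hx
  have hx0 := x.2.1
  have hb1 := b.2.2
  have hb' : (b : ℝ) = 0 ∨ (b : ℝ) = 1 :=
    (unitInterval.isIdem_iff.1 hb).imp (congrArg Subtype.val) (congrArg Subtype.val)
  have hleast : IsLeast {z : unitInterval | z ≤ b ∧ z + x = b}
      ⟨(b : ℝ) - x, by linarith, by linarith⟩ := by
    refine ⟨⟨?_, Subtype.ext ?_⟩, ?_⟩
    · change (b : ℝ) - x ≤ b
      linarith
    · rw [unitInterval.coe_emv_add, sub_add_cancel, min_eq_left hb1]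
    · rintro z ⟨-, hz⟩
      have hz' := congrArg Subtype.val hz
      rw [unitInterval.coe_emv_add] at hz'
      change (b : ℝ) - x ≤ z
      have := min_le_left ((z : ℝ) + x) 1
      linarith
  have hex : ∃ w, IsLeast {z : unitInterval | z ≤ b ∧ z + x = b} w := ⟨_, hleast⟩
  rw [lam, dif_pos hex, hex.choose_spec.unique hleast]

/-! ### The space of state-morphisms. -/

namespace StateMorphism

variable {M : Type*} [EMVAlgebra M]

theorem monotone (s : StateMorphism M) : Monotone s.1.toFun := fun x y h => by
  rw [← inf_eq_left, ← s.1.map_inf, inf_eq_left.2 h]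

theorem isIdem_map (s : StateMorphism M) {a : M} (ha : IsIdem a) : IsIdem (s.1.toFun a) := by
  rw [IsIdem, ← s.1.map_add, ha]

/-- Idempotents map to `0` or `1`, which turns the open condition of positivity into a closed one.
-/
theorem mem_stateSupport_iff {a : M} (ha : IsIdem a) (s : StateMorphism M) :
    s ∈ stateSupport a ↔ s.1.toFun a = 1 := by
  change 0 < s.1.toFun a ↔ _
  rcases unitInterval.isIdem_iff.1 (s.isIdem_map ha) with h | h <;> rw [h] <;> simp

theorem isEmbedding_toFun :
    Topology.IsEmbedding (fun s : StateMorphism M => (s.1.toFun : M → unitInterval)) := by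
  refine ⟨⟨rfl⟩, ?_⟩
  rintro ⟨⟨f, _, _, _, _, _⟩, _⟩ ⟨⟨g, _, _, _, _, _⟩, _⟩ h
  obtain rfl : f = g := h
  rfl

theorem continuous_eval (x : M) : Continuous fun s : StateMorphism M => s.1.toFun x :=
  (continuous_apply x).comp isEmbedding_toFun.continuous

theorem isClopen_stateSupport {a : M} (ha : IsIdem a) : IsClopen (stateSupport a) := by
  refine ⟨?_, isOpen_lt continuous_const (continuous_eval a)⟩
  convert isClosed_eq (continuous_eval a) (continuous_const (y := (1 : unitInterval))) using 1
  ext s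
  exact mem_stateSupport_iff ha s

/-- The image in `[0, 1]^M` of the state-morphisms with value `1` at an idempotent is closed. -/
theorem isCompact_stateSupport {a : M} (ha : IsIdem a) : IsCompact (stateSupport a) := by
  rw [isEmbedding_toFun.isCompact_iff]
  -- The condition `f a = 1` keeps the value `1` attained in the limit; merely asking for some `x`
  -- with `f x = 1` would not be visibly closed.
  let C : Set (M → unitInterval) := {f | (∀ x y, f (x ⊔ y) = f x ⊔ f y) ∧
    (∀ x y, f (x ⊓ y) = f x ⊓ f y) ∧ (∀ x y, f (x + y) = f x + f y) ∧ f 0 = 0 ∧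
    (∀ b, IsIdem b → ∀ x, x ≤ b → (f (lam b x) : ℝ) = f b - f x) ∧ f a = 1}
  have hC : IsClosed C := by
    have hadd : ∀ x y : M, Continuous fun f : M → unitInterval => f x + f y := fun x y => by
      refine continuous_induced_rng.2 ?_
      change Continuous fun f : M → unitInterval => min ((f x : ℝ) + f y) 1
      fun_prop
    simp only [C, Set.ofPred_and, Set.ofPred_forall]
    refine IsClosed.inter ?_ (IsClosed.inter ?_ (IsClosed.inter ?_ (IsClosed.inter ?_
      (IsClosed.inter ?_ ?_))))
    · exact isClosed_iInter fun x => isClosed_iInter fun y => isClosed_eq (by fun_prop)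
        ((continuous_apply x).sup (continuous_apply y))
    · exact isClosed_iInter fun x => isClosed_iInter fun y => isClosed_eq (by fun_prop)
        ((continuous_apply x).inf (continuous_apply y))
    · exact isClosed_iInter fun x => isClosed_iInter fun y => isClosed_eq (by fun_prop)
        (hadd x y)
    · exact isClosed_eq (by fun_prop) continuous_const
    · exact isClosed_iInter fun b => isClosed_iInter fun _ => isClosed_iInter fun x =>
        isClosed_iInter fun _ => isClosed_eq (by fun_prop) (by fun_prop)
    · exact isClosed_eq (by fun_prop) continuous_const
  convert hC.isCompact using 1
  ext f
  constructor
  · rintro ⟨s, hs, rfl⟩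
    refine ⟨s.1.map_sup, s.1.map_inf, s.1.map_add, s.1.map_zero, fun b hb x hx => ?_,
      (mem_stateSupport_iff ha s).1 hs⟩
    change (s.1.toFun (lam b x) : ℝ) = s.1.toFun b - s.1.toFun x
    rw [s.1.map_lam b hb x hx, unitInterval.coe_lam (s.isIdem_map hb) (s.monotone hx)]
  · rintro ⟨h1, h2, h3, h4, h5, h6⟩
    refine ⟨⟨⟨f, h1, h2, h3, h4, fun b hb x hx => Subtype.ext ?_⟩, a, h6⟩, ?_, rfl⟩
    · rw [h5 b hb x hx, unitInterval.coe_lam]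
      · rw [IsIdem, ← h3, hb]
      · rw [← inf_eq_left, ← h2, inf_eq_left.2 hx]
    · exact (mem_stateSupport_iff ha _).2 h6

theorem mem_stateSupport_of_le {x a : M} {s : StateMorphism M} (hx : s.1.toFun x = 1)
    (h : x ≤ a) : s ∈ stateSupport a :=
  lt_of_lt_of_le (by rw [hx]; exact zero_lt_one) (s.monotone h)

instance : T2Space (StateMorphism M) := isEmbedding_toFun.t2Space

instance : WeaklyLocallyCompactSpace (StateMorphism M) := by
  refine ⟨fun s => ?_⟩
  obtain ⟨x, hx⟩ := s.2
  obtain ⟨a, ha, hxa⟩ := exists_idem_ge x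
  exact ⟨_, isCompact_stateSupport ha,
    (isClopen_stateSupport ha).isOpen.mem_nhds (mem_stateSupport_of_le hx hxa)⟩

end StateMorphism

theorem mainTheorem5 (M : Type*) [EMVAlgebra M] :
    (LocallyCompactSpace (StateMorphism M) ∧ T2Space (StateMorphism M)) ∧
    (LocallyCompactSpace (MaxI M) ∧ T2Space (MaxI M)) ∧
    (∀ a : M, IsIdem a →
      (IsCompact (stateSupport a) ∧ IsClopen (stateSupport a)) ∧
      (IsCompact (idealSupport a) ∧ IsClopen (idealSupport a))) ∧
    ((∃ t : M, ∀ x : M, x ≤ t) →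
      CompactSpace (StateMorphism M) ∧ CompactSpace (MaxI M)) := by
  -- One compact neighbourhood per point suffices for local compactness in a Hausdorff space.
  refine ⟨⟨inferInstance, inferInstance⟩, ⟨inferInstance, inferInstance⟩, fun a ha =>
    ⟨⟨StateMorphism.isCompact_stateSupport ha, StateMorphism.isClopen_stateSupport ha⟩,
      MaxI.isCompact_idealSupport ha, MaxI.isClosed_idealSupport ha, MaxI.isOpen_idealSupport a⟩,
    ?_⟩
  rintro ⟨t, ht⟩
  -- Every state-morphism is `1` at `t` and no proper ideal contains `t`, so `S(t)` and `M(t)` are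
  -- the whole spaces.
  have hti : IsIdem t := le_antisymm (ht _) (le_self_add t t)
  constructor
  · rw [← isCompact_univ_iff]
    convert StateMorphism.isCompact_stateSupport hti using 1
    refine (Set.eq_univ_of_forall fun s => ?_).symm
    obtain ⟨x, hx⟩ := s.2
    exact StateMorphism.mem_stateSupport_of_le hx (ht x)
  · rw [← isCompact_univ_iff]
    convert MaxI.isCompact_idealSupport hti using 1
    exact (Set.eq_univ_of_forall fun A h => A.2.prop.2
      (Set.eq_univ_of_forall fun x => A.isEMVIdeal.mem_of_le x t (ht x) h)).symm
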